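/- **Model.** A circuit over input variables $(x_i)_{i\in\iota}$ ($\iota$ finite) is a finite directed acyclic graph whose vertices are inputs (variables or constants in $\{0,1\}$; variables may occur repeatedly) and gates, with one vertex designated as the output. Each gate applies an arbitrary Boolean function to the bits on its incoming wires. For $a,b\in[0,1]$, a gate is $(a,b)$-noisy if, when its correct result is $Y$, it outputs $Z$ with $\mathbb P(Z=1\mid Y=0)=a$ and $\mathbb P(Z=0\mid Y=1)=b$; the noise at different gates is independent, and inputs are noiseless. The depth of a circuit is the largest number of gates on a directed path to its output. Put $$c_{a,b}=1-\left(\sqrt{b(1-a)}+\sqrt{a(1-b)}\right)^2,\qquad h(p)=-p\log_2p-(1-p)\log_2(1-p),\quad h(0)=h(1)=0.$$ **Theorem.** Let $f:\{0,1\}^\iota\to\{0,1\}$ be a function that depends on exactly $n\ge1$ of its inputs ($f$ depends on $x_i$ if changing $x_i$ alone can change the value of $f$). Let $C$ be a circuit of depth $d$ whose gates have at most $k$ inputs each and are independently $(a,b)$-noisy. Let $\delta\le\frac12$, and suppose that $C$ computes $f$ $\delta$-reliably, that is, for every $x\in\{0,1\}^\iota$ the output of $C$ on input $x$ differs from $f(x)$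 with probability at most $\delta$. Put $\Delta=1-h(\delta)$ and $c=c_{a,b}$. 1. If $ck>1$, then $d\ge\dfrac{\log(n\Delta)}{\log(ck)}$ (for $\Delta=0$ the right-hand side is read as $-\infty$, so nothing is asserted beyond $d\ge0$). 2. If $ck\le1$, then $\Delta\le\dfrac1n$. -/

import Mathlib

/-- A vertex of a circuit: a variable input, a constant input, or a gate. -/
inductive CircuitVertex (ι G : Type*) where
  | input (i : ι) : CircuitVertex ι G
  | const (v : Bool) : CircuitVertex ι G
  | gate (g : G) : CircuitVertex ι G

/-- A finite Boolean circuit over the input variables `ι`: a directed acyclic graph in which the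
gate `g` has `arity g` incoming wires, the `p`-th of them coming from the vertex `wire g p`, and
computes the Boolean function `op g` of the values they carry. Fan-out is unrestricted and a
variable may be read any number of times. -/
structure BoolCircuit (ι : Type*) where
  Gate : Type
  [fintypeGate : Fintype Gate]
  arity : Gate → ℕ
  wire : (g : Gate) → Fin (arity g) → CircuitVertex ι Gate
  op : (g : Gate) → (Fin (arity g) → Bool) → Bool
  /-- There is no directed cycle: the relation "a wire leads from `g'` into `g`" is well founded
  (on a finite set this is acyclicity). -/
  acyclic : WellFounded (fun g' g : Gate => ∃ p, wire g p = CircuitVertex.gate g')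
  /-- The output vertex. -/
  out : CircuitVertex ι Gate

attribute [instance] BoolCircuit.fintypeGate

/-- The `(a, b)`-noisy binary channel: the probability of emitting `z` when the correct value is
`y`. A correct `0` is corrupted with probability `a`, a correct `1` with probability `b`. -/
def noisyChannel (a b : ℝ) : Bool → Bool → ℝ
  | false, true => a
  | false, false => 1 - a
  | true, false => b
  | true, true => 1 - b

namespace BoolCircuit

variable {ι : Type*}

/-- The value leaving a vertex, for the input assignment `x` and gate outputs `z`. -/
def value (C : BoolCircuit ι) (x : ι → Bool) (z : C.Gate → Bool) :
    CircuitVertex ι C.Gate → Bool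
  | .input i => x i
  | .const v => v
  | .gate g => z g

/-- The pre-noise result of the gate `g`, computed from the (noisy) values on its incoming wires. -/
def preNoise (C : BoolCircuit ι) (x : ι → Bool) (z : C.Gate → Bool) (g : C.Gate) : Bool :=
  C.op g (fun p => C.value x z (C.wire g p))

/-- The probability that, on the input `x`, the gates emit exactly the values `z`, when every gate
is independently `(a, b)`-noisy: given the values it receives, each gate sends its result through
its own copy of the channel. -/
noncomputable def jointProb (C : BoolCircuit ι) (a b : ℝ) (x : ι → Bool) (z : C.Gate → Bool) : ℝ :=
  ∏ g, noisyChannel a b (C.preNoise x z g) (z g)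

open Classical in
/-- The probability that the circuit with independently `(a, b)`-noisy gates, run on the input `x`,
has an output different from `f x`. -/
noncomputable def errorProb (C : BoolCircuit ι) (a b : ℝ) (f : (ι → Bool) → Bool)
    (x : ι → Bool) : ℝ :=
  ∑ z : C.Gate → Bool, if C.value x z C.out ≠ f x then C.jointProb a b x z else 0

/-- The largest number of gates on a directed path ending in the gate `g` (`g` included). -/
noncomputable def gateDepth (C : BoolCircuit ι) : C.Gate → ℕ :=
  C.acyclic.fix fun g depthOf =>
    1 + Finset.univ.sup fun p : Fin (C.arity g) =>
      match h : C.wire g p with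
      | .input _ => 0
      | .const _ => 0
      | .gate g' => depthOf g' ⟨p, h⟩

/-- The largest number of gates on a directed path ending in the given vertex. -/
noncomputable def vertexDepth (C : BoolCircuit ι) : CircuitVertex ι C.Gate → ℕ
  | .input _ => 0
  | .const _ => 0
  | .gate g => C.gateDepth g

/-- The depth of a circuit: the largest number of gates on a directed path to the output. -/
noncomputable def depth (C : BoolCircuit ι) : ℕ := C.vertexDepth C.out

theorem gateDepth_eq (C : BoolCircuit ι) (g : C.Gate) :
    C.gateDepth g = 1 + Finset.univ.sup fun p : Fin (C.arity g) => C.vertexDepth (C.wire g p) := by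
  unfold gateDepth
  rw [WellFounded.fix_eq]
  congr 2
  funext p
  split <;> rename_i h <;> exact congrArg C.vertexDepth h.symm

theorem jointProb_nonneg (C : BoolCircuit ι) {a b : ℝ} (ha : a ∈ Set.Icc (0 : ℝ) 1)
    (hb : b ∈ Set.Icc (0 : ℝ) 1) (x : ι → Bool) (z : C.Gate → Bool) : 0 ≤ C.jointProb a b x z := by
  obtain ⟨ha0, ha1⟩ := ha
  obtain ⟨hb0, hb1⟩ := hb
  refine Finset.prod_nonneg fun g _ => ?_
  cases C.preNoise x z g <;> cases z g <;> simp [noisyChannel] <;> assumption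

open Classical in
theorem preNoise_update (C : BoolCircuit ι) (x : ι → Bool) (z : C.Gate → Bool) (m g : C.Gate)
    (v : Bool) (h : ¬ ∃ p, C.wire g p = CircuitVertex.gate m) :
    C.preNoise x (Function.update z m v) g = C.preNoise x z g := by
  unfold preNoise
  congr 1
  funext p
  cases hw : C.wire g p with
  | input i => rfl
  | const v => rfl
  | gate g' =>
    have hne : g' ≠ m := fun e => h ⟨p, by rw [hw, e]⟩
    simp [value, hne]

open Classical in
/-- The joint probabilities of the gate outputs add up to one. -/
theorem sum_jointProb (C : BoolCircuit ι) (a b : ℝ) (x : ι → Bool) :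
    ∑ z : C.Gate → Bool, C.jointProb a b x z = 1 := by
  let r : C.Gate → C.Gate → Prop := fun g' g => ∃ p, C.wire g p = CircuitVertex.gate g'
  have hwf : WellFounded (Function.swap (Relation.TransGen r)) := by
    have : IsStrictOrder C.Gate (Function.swap (Relation.TransGen r)) :=
      { irrefl := fun g hg => (C.acyclic.transGen.irrefl).irrefl g hg
        trans := fun _ _ _ h1 h2 => h2.trans h1 }
    exact Finite.wellFounded_of_trans_of_irrefl _
  have key : ∀ (N : ℕ) (S : Finset C.Gate), S.card = N →
      (∑ z : C.Gate → Bool, ∏ g ∈ S, noisyChannel a b (C.preNoise x z g) (z g)) * 2 ^ N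
        = 2 ^ Fintype.card C.Gate := by
    intro N
    induction N with
    | zero =>
      intro S hS
      rw [Finset.card_eq_zero] at hS
      subst hS
      simp
    | succ N ih =>
      intro S hS
      have hne : S.Nonempty := by
        rw [← Finset.card_pos]; omega
      obtain ⟨m, hm, hmax⟩ := hwf.has_min (S : Set C.Gate) hne
      have hno : ∀ g ∈ S, ¬ r m g := fun g hg hr => hmax g hg (Relation.TransGen.single hr)
      have hcard : (S.erase m).card = N := by
        rw [Finset.card_erase_of_mem hm]; omega
      have hstep := ih (S.erase m) hcard
      let flip : (C.Gate → Bool) → (C.Gate → Bool) := fun z => Function.update z m (!z m)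
      have hflip : Function.Involutive flip := by
        intro z
        funext g
        by_cases hg : g = m
        · subst hg; simp [flip]
        · simp [flip, hg]
      let F : (C.Gate → Bool) → ℝ := fun z =>
        ∏ g ∈ S.erase m, noisyChannel a b (C.preNoise x z g) (z g)
      let K : (C.Gate → Bool) → ℝ := fun z => noisyChannel a b (C.preNoise x z m) (z m)
      have hF : ∀ z, F (flip z) = F z := by
        intro z
        refine Finset.prod_congr rfl fun g hg => ?_
        have hgm : g ≠ m := Finset.ne_of_mem_erase hg
        have h1 : C.preNoise x (flip z) g = C.preNoise x z g :=
          C.preNoise_update x z m g _ (hno g (Finset.mem_of_mem_erase hg))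
        rw [h1]
        simp [flip, hgm]
      have hK : ∀ z, K z + K (flip z) = 1 := by
        intro z
        have h1 : C.preNoise x (flip z) m = C.preNoise x z m :=
          C.preNoise_update x z m m _ (hno m hm)
        have h2 : flip z m = !z m := by simp [flip]
        simp only [K, h1, h2]
        cases C.preNoise x z m <;> cases z m <;> simp [noisyChannel]
      have hsplit : ∀ z : C.Gate → Bool,
          ∏ g ∈ S, noisyChannel a b (C.preNoise x z g) (z g) = F z * K z := by
        intro z
        rw [← Finset.mul_prod_erase S _ hm, mul_comm]
      have hsym : ∑ z, F z * K z = ∑ z, F z * K (flip z) := by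
        rw [← Equiv.sum_comp hflip.toPerm]
        refine Finset.sum_congr rfl fun z _ => ?_
        change F (flip z) * K (flip z) = _
        rw [hF]
      have htwo : (∑ z, F z * K z) * 2 = ∑ z, F z := by
        rw [mul_two]
        nth_rewrite 2 [hsym]
        rw [← Finset.sum_add_distrib]
        refine Finset.sum_congr rfl fun z _ => ?_
        rw [← mul_add, hK, mul_one]
      rw [Finset.sum_congr rfl fun z _ => hsplit z, pow_succ', ← mul_assoc, htwo]
      exact hstep
  have h := key (Fintype.card C.Gate) Finset.univ Finset.card_univ
  have h2 : (2 : ℝ) ^ Fintype.card C.Gate ≠ 0 := by positivity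
  exact mul_right_cancel₀ h2 (by rw [one_mul]; exact h)

/-- The circuit, with independently `(a, b)`-noisy gates, computes `f` `δ`-reliably: on every
input the probability of error is at most `δ`. -/
def ComputesReliably (C : BoolCircuit ι) (a b : ℝ) (f : (ι → Bool) → Bool) (δ : ℝ) : Prop :=
  ∀ x : ι → Bool, C.errorProb a b f x ≤ δ

end BoolCircuit

/-- `f` depends on its `i`-th input: changing that input alone can change the value of `f`. -/
def DependsOnInput {ι : Type*} (f : (ι → Bool) → Bool) (i : ι) : Prop :=
  ∃ x y : ι → Bool, (∀ j, j ≠ i → x j = y j) ∧ f x ≠ f y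

/-- The binary entropy function in bits, `h p = -p log₂ p - (1 - p) log₂ (1 - p)`
(Mathlib's `Real.binEntropy` uses the natural logarithm). -/
noncomputable def binEntropyBits (p : ℝ) : ℝ := Real.binEntropy p / Real.log 2

/-- The information transmission factor `c_{a,b}` of the `(a, b)`-noisy binary channel. -/
noncomputable def transmissionFactor (a b : ℝ) : ℝ :=
  1 - (Real.sqrt (b * (1 - a)) + Real.sqrt (a * (1 - b))) ^ 2

/-!
Fix a variable `i` on which `f` depends, and two inputs that differ only at `i` and on which `f`
takes different values. Let `X` be a uniform sign choosing between them. The information that an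
observation `Y` carries about `X` is measured by `J(Y) = E[E[X | Y] ^ 2]`, the triangular
discrimination `triDisc` of the two conditional laws of `Y`, rather than by Shannon's mutual
information. It lies between `0` and `1`, decreases under data processing, and increases, when
observations are added, by a variance. This turns the strong data processing inequality
`triDisc_noisyChannel_le` into a statement about the correlation of the input and the output of a
binary channel: next to any side information, the `(a, b)`-noisy channel keeps at most the fraction
`c = transmissionFactor a b` of what its input bit would add. Behind it is the elementary
inequality `sq_mul_le_transmissionFactor_mul`.

Consequently a gate `m` that no other gate under consideration reads may be traded for its incoming
wires, `J(S, m) ≤ (1 - c) J(S) + c J(S, wires of m)` (`triDisc_values_insert_le`). Trading in all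
gates, deepest first, leaves
`J(out) ≤ ∑ c ^ (number of gates on the path)`, the sum being over the directed paths from the
variable `i` to the output (`triDisc_values_le`). On the other hand, reliability forces
`J(out) ≥ (1 - 2 δ) ^ 2` by the Cauchy-Schwarz inequality (`sq_le_triDisc_of_error_le`), and
`(1 - 2 δ) ^ 2 ≥ 1 - h δ = Δ` (`one_sub_binEntropyBits_le`).

Adding up over the `n` relevant variables, `n Δ` is at most the total weight of all paths from
variables to the output, which is at most `max 1 (c k) ^ d` because each gate reads at most `k`
wires (`sum_pathWeight_le`). Both claims follow.
-/

/-! ### A quadratic lower bound for the binary entropy -/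

/-- The binary entropy lies above the parabola with the same zeros and the same maximum. With
`G p = h p - 4 p (1 - p) log 2`, the second derivative `8 log 2 - 1 / (p (1 - p))` makes `G` concave
near the endpoints, and convex and symmetric about `1/2` in between. -/
theorem four_mul_log_two_le_binEntropy {p : ℝ} (hp0 : 0 ≤ p) (hp : p ≤ 1 / 2) :
    4 * p * (1 - p) * Real.log 2 ≤ Real.binEntropy p := by
  have hl := Real.log_two_gt_d9
  set l := Real.log 2 with hldef
  let G : ℝ → ℝ := fun p => Real.binEntropy p - 4 * l * (p * (1 - p))
  have hGc : Continuous G := by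
    have := Real.binEntropy_continuous
    fun_prop
  have hd1 : ∀ q ∈ Set.Ioo (0 : ℝ) 1,
      HasDerivAt G (Real.log (1 - q) - Real.log q - 4 * l * (1 - 2 * q)) q := by
    rintro q ⟨h0, h1⟩
    have h2 : HasDerivAt (fun q : ℝ => 4 * l * (q * (1 - q))) (4 * l * (1 - 2 * q)) q := by
      have h3 := (((hasDerivAt_id' q).mul ((hasDerivAt_id' q).const_sub 1))).const_mul (4 * l)
      exact h3.congr_deriv (by ring)
    exact (Real.hasDerivAt_binEntropy h0.ne' h1.ne).sub h2
  have hd2 : ∀ q ∈ Set.Ioo (0 : ℝ) 1,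
      HasDerivAt (deriv G) (8 * l - 1 / (q * (1 - q))) q := by
    rintro q ⟨h0, h1⟩
    have h4 : HasDerivAt (fun q => Real.log (1 - q) - Real.log q - 4 * l * (1 - 2 * q))
        (8 * l - 1 / (q * (1 - q))) q := by
      have e1 := ((hasDerivAt_id' q).const_sub 1).log (sub_pos.2 h1).ne'
      have e2 := Real.hasDerivAt_log h0.ne'
      have e3 := (((hasDerivAt_id' q).const_mul 2).const_sub 1).const_mul (4 * l)
      refine ((e1.sub e2).sub e3).congr_deriv ?_
      have h0' := h0.ne'
      have h1' : (1 : ℝ) - q ≠ 0 := (sub_pos.2 h1).ne'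
      field_simp
      ring
    refine h4.congr_of_eventuallyEq ?_
    filter_upwards [Ioo_mem_nhds h0 h1] with y hy using (hd1 y hy).deriv
  have hit : ∀ q ∈ Set.Ioo (0 : ℝ) 1, deriv^[2] G q = 8 * l - 1 / (q * (1 - q)) :=
    fun q hq => (hd2 q hq).deriv
  have hG0 : G 0 = 0 := by simp [G]
  have hGh : G (1 / 2) = 0 := by
    simp only [G, one_div, Real.binEntropy_two_inv]
    rw [← hldef]
    ring
  have hGs : ∀ q, G (1 - q) = G q := by
    intro q
    simp only [G, Real.binEntropy_one_sub]
    ring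
  -- `r` is the smaller of the two zeros of the second derivative.
  set s := Real.sqrt (1 - 1 / (2 * l)) with hs
  have hl0 : 0 < l := by linarith
  have hinv : 1 / (2 * l) ≤ 1 := by rw [div_le_one (by linarith)]; linarith
  have hinv0 : 0 < 1 / (2 * l) := by positivity
  have hs2 : s ^ 2 = 1 - 1 / (2 * l) := Real.sq_sqrt (by linarith)
  have hs0 : 0 ≤ s := Real.sqrt_nonneg _
  have hs1 : s < 1 := by nlinarith
  set r := (1 - s) / 2 with hr
  have hr0 : 0 < r := by rw [hr]; linarith
  have hrh : r ≤ 1 / 2 := by rw [hr]; linarith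
  have hrr : 8 * l * (r * (1 - r)) = 1 := by
    have : r * (1 - r) = (1 - s ^ 2) / 4 := by rw [hr]; ring
    rw [this, hs2]
    field_simp
    ring
  have hconv : ConvexOn ℝ (Set.Icc r (1 - r)) G := by
    refine convexOn_of_deriv2_nonneg (convex_Icc _ _) hGc.continuousOn ?_ ?_ ?_ <;>
      rw [interior_Icc]
    · intro q hq
      exact (hd1 q ⟨by linarith [hq.1], by linarith [hq.2]⟩).differentiableAt.differentiableWithinAt
    · intro q hq
      exact (hd2 q ⟨by linarith [hq.1], by linarith [hq.2]⟩).differentiableAt.differentiableWithinAt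
    · rintro q ⟨h1, h2⟩
      have hq0 : 0 < q * (1 - q) := mul_pos (by linarith) (by linarith)
      rw [hit q ⟨by linarith, by linarith⟩, sub_nonneg, div_le_iff₀ hq0, ← hrr]
      exact mul_le_mul_of_nonneg_left (by nlinarith) (by linarith)
  have hconc : ConcaveOn ℝ (Set.Icc 0 r) G := by
    refine concaveOn_of_deriv2_nonpos (convex_Icc _ _) hGc.continuousOn ?_ ?_ ?_ <;>
      rw [interior_Icc]
    · intro q hq
      exact (hd1 q ⟨by linarith [hq.1], by linarith [hq.2]⟩).differentiableAt.differentiableWithinAt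
    · intro q hq
      exact (hd2 q ⟨by linarith [hq.1], by linarith [hq.2]⟩).differentiableAt.differentiableWithinAt
    · rintro q ⟨h1, h2⟩
      have hq0 : 0 < q * (1 - q) := mul_pos (by linarith) (by linarith)
      rw [hit q ⟨by linarith, by linarith⟩, sub_nonpos, le_div_iff₀ hq0, ← hrr]
      exact mul_le_mul_of_nonneg_left (by nlinarith) (by linarith)
  have hmid : ∀ q, r ≤ q → q ≤ 1 / 2 → 0 ≤ G q := by
    intro q h1 h2
    have hq : q ∈ Set.Icc r (1 - r) := ⟨h1, by linarith⟩
    have hq' : 1 - q ∈ Set.Icc r (1 - r) := ⟨by linarith, by linarith⟩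
    have hh : (0 : ℝ) ≤ 1 / 2 := by norm_num
    have h3 := hconv.2 hq hq' hh hh (by norm_num)
    have h4 : (1 / 2 : ℝ) • q + (1 / 2 : ℝ) • (1 - q) = 1 / 2 := by
      simp only [smul_eq_mul]; ring
    rw [h4, hGh, hGs] at h3
    simp only [smul_eq_mul] at h3
    linarith
  have hG : 0 ≤ G p := by
    rcases le_total r p with h | h
    · exact hmid p h hp
    · have h3 := hconc.min_le_of_mem_Icc (x := 0) (y := r) (z := p) ⟨le_rfl, hr0.le⟩
        ⟨hr0.le, le_rfl⟩ ⟨hp0, h⟩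
      rw [hG0] at h3
      exact (le_min le_rfl (hmid r le_rfl hrh)).trans h3
  simp only [G] at hG
  linarith

/-- In bits, the capacity `1 - h p` of a symmetric channel is at most its squared correlation. -/
theorem one_sub_binEntropyBits_le {p : ℝ} (hp0 : 0 ≤ p) (hp : p ≤ 1 / 2) :
    1 - binEntropyBits p ≤ (1 - 2 * p) ^ 2 := by
  have h := four_mul_log_two_le_binEntropy hp0 hp
  rw [← le_div_iff₀ (Real.log_pos one_lt_two)] at h
  unfold binEntropyBits
  linarith

/-! ### Contraction of the triangular discrimination under a binary channel -/

/-- With the convention `0 / 0 = 0`, the defect in `(x + y)² / (u + v) ≤ x² / u + y² / v` is the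
square of a determinant over `u v (u + v)`. -/
theorem sq_div_add_sq_div_sub {x y u v : ℝ} (hx : |x| ≤ u) (hy : |y| ≤ v) :
    x ^ 2 / u + y ^ 2 / v - (x + y) ^ 2 / (u + v) =
      (x * v - y * u) ^ 2 / (u * v * (u + v)) := by
  rcases (abs_nonneg x |>.trans hx).eq_or_lt with hu | hu
  · have : x = 0 := abs_nonpos_iff.1 (hu ▸ hx)
    simp [this, ← hu]
  rcases (abs_nonneg y |>.trans hy).eq_or_lt with hv | hv
  · have : y = 0 := abs_nonpos_iff.1 (hv ▸ hy)
    simp [this, ← hv]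
  field_simp
  ring

theorem transmissionFactor_eq {a b : ℝ} (ha : a ∈ Set.Icc (0 : ℝ) 1) (hb : b ∈ Set.Icc (0 : ℝ) 1) :
    transmissionFactor a b = (1 - a) * (1 - b) + a * b
      - 2 * (Real.sqrt (b * (1 - a)) * Real.sqrt (a * (1 - b))) := by
  obtain ⟨ha0, ha1⟩ := ha
  obtain ⟨hb0, hb1⟩ := hb
  have h1 := Real.sq_sqrt (mul_nonneg hb0 (sub_nonneg.2 ha1))
  have h2 := Real.sq_sqrt (mul_nonneg ha0 (sub_nonneg.2 hb1))
  unfold transmissionFactor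
  linear_combination -h1 - h2

theorem transmissionFactor_le_one (a b : ℝ) : transmissionFactor a b ≤ 1 := by
  unfold transmissionFactor
  linarith [sq_nonneg (Real.sqrt (b * (1 - a)) + Real.sqrt (a * (1 - b)))]

theorem transmissionFactor_nonneg {a b : ℝ} (ha : a ∈ Set.Icc (0 : ℝ) 1)
    (hb : b ∈ Set.Icc (0 : ℝ) 1) : 0 ≤ transmissionFactor a b := by
  rw [transmissionFactor_eq ha hb]
  obtain ⟨ha0, ha1⟩ := ha
  obtain ⟨hb0, hb1⟩ := hb
  have h1 := Real.sq_sqrt (mul_nonneg hb0 ha0)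
  have h2 := Real.sq_sqrt (mul_nonneg (sub_nonneg.2 ha1) (sub_nonneg.2 hb1))
  have h3 : Real.sqrt (b * (1 - a)) * Real.sqrt (a * (1 - b))
      = Real.sqrt (b * a) * Real.sqrt ((1 - a) * (1 - b)) := by
    rw [← Real.sqrt_mul (mul_nonneg hb0 (sub_nonneg.2 ha1)), ← Real.sqrt_mul (mul_nonneg hb0 ha0)]
    congr 1
    ring
  rw [h3]
  nlinarith [sq_nonneg (Real.sqrt (b * a) - Real.sqrt ((1 - a) * (1 - b)))]

/-- The squared correlation between the input and the output of the `(a, b)`-noisy channel is at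
most the transmission factor, whatever the law `(u, v)` of the input bit. The product of the two
outgoing masses is minimised, for a given `u v`, when its two square terms are balanced. -/
theorem sq_mul_le_transmissionFactor_mul {a b u v : ℝ} (ha : a ∈ Set.Icc (0 : ℝ) 1)
    (hb : b ∈ Set.Icc (0 : ℝ) 1) :
    (1 - a - b) ^ 2 * (u * v) ≤
      transmissionFactor a b * ((u * (1 - a) + v * b) * (u * a + v * (1 - b))) := by
  have hc := transmissionFactor_nonneg ha hb
  have hce := transmissionFactor_eq ha hb
  obtain ⟨ha0, ha1⟩ := ha
  obtain ⟨hb0, hb1⟩ := hb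
  have hB := mul_nonneg hb0 (sub_nonneg.2 ha1)
  have hA := mul_nonneg ha0 (sub_nonneg.2 hb1)
  set R := Real.sqrt (b * (1 - a)) * Real.sqrt (a * (1 - b)) with hR
  have hR2 : R ^ 2 = (b * (1 - a)) * (a * (1 - b)) := by
    rw [hR, mul_pow, Real.sq_sqrt hB, Real.sq_sqrt hA]
  have hRe : R = Real.sqrt (a * (1 - a)) * Real.sqrt (b * (1 - b)) := by
    rw [hR, ← Real.sqrt_mul hB, ← Real.sqrt_mul (mul_nonneg ha0 (sub_nonneg.2 ha1))]
    congr 1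
    ring
  have h1 := Real.sq_sqrt (mul_nonneg ha0 (sub_nonneg.2 ha1))
  have h2 := Real.sq_sqrt (mul_nonneg hb0 (sub_nonneg.2 hb1))
  have hmass : (2 * R + ((1 - a) * (1 - b) + a * b)) * (u * v) ≤
      (u * (1 - a) + v * b) * (u * a + v * (1 - b)) := by
    rw [hRe]
    linear_combination sq_nonneg (u * Real.sqrt (a * (1 - a)) - v * Real.sqrt (b * (1 - b)))
      + u ^ 2 * h1 + v ^ 2 * h2
  refine le_trans (le_of_eq ?_) (mul_le_mul_of_nonneg_left hmass hc)
  rw [hce]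
  linear_combination 4 * u * v * hR2

/-- Two signed masses `x, y`, dominated by `u, v`, are sent through the `(a, b)`-noisy channel. What
`x² / u + y² / v` exceeds its coarsening `(x + y)² / (u + v)` by shrinks by the transmission
factor. -/
theorem noisyChannel_sq_div_le {a b x y u v : ℝ} (ha : a ∈ Set.Icc (0 : ℝ) 1)
    (hb : b ∈ Set.Icc (0 : ℝ) 1) (hx : |x| ≤ u) (hy : |y| ≤ v) :
    (x * (1 - a) + y * b) ^ 2 / (u * (1 - a) + v * b)
        + (x * a + y * (1 - b)) ^ 2 / (u * a + v * (1 - b)) ≤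
      (1 - transmissionFactor a b) * ((x + y) ^ 2 / (u + v))
        + transmissionFactor a b * (x ^ 2 / u + y ^ 2 / v) := by
  have hu := (abs_nonneg x).trans hx
  have hv := (abs_nonneg y).trans hy
  have hkey := sq_mul_le_transmissionFactor_mul (u := u) (v := v) ha hb
  have hc := transmissionFactor_nonneg ha hb
  set c := transmissionFactor a b
  obtain ⟨ha0, ha1⟩ := ha
  obtain ⟨hb0, hb1⟩ := hb
  have hdom : ∀ s t : ℝ, 0 ≤ s → 0 ≤ t → |x * s + y * t| ≤ u * s + v * t := by
    intro s t hs ht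
    refine (abs_add_le _ _).trans ?_
    rw [abs_mul, abs_mul, abs_of_nonneg hs, abs_of_nonneg ht]
    gcongr
  have hin := sq_div_add_sq_div_sub hx hy
  have hout := sq_div_add_sq_div_sub (hdom (1 - a) b (by linarith) hb0)
    (hdom a (1 - b) ha0 (by linarith))
  have e1 : x * (1 - a) + y * b + (x * a + y * (1 - b)) = x + y := by ring
  have e2 : u * (1 - a) + v * b + (u * a + v * (1 - b)) = u + v := by ring
  have e3 : (x * (1 - a) + y * b) * (u * a + v * (1 - b))
      - (x * a + y * (1 - b)) * (u * (1 - a) + v * b) = (1 - a - b) * (x * v - y * u) := by ring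
  rw [e1, e2, e3] at hout
  set M := u * (1 - a) + v * b
  set N := u * a + v * (1 - b)
  have hM : 0 ≤ M := add_nonneg (mul_nonneg hu (by linarith)) (mul_nonneg hv hb0)
  have hN : 0 ≤ N := add_nonneg (mul_nonneg hu ha0) (mul_nonneg hv (by linarith))
  have hgap : ((1 - a - b) * (x * v - y * u)) ^ 2 / (M * N * (u + v)) ≤
      c * ((x * v - y * u) ^ 2 / (u * v * (u + v))) := by
    rcases hu.eq_or_lt with hu0 | hu0
    · have : x = 0 := abs_nonpos_iff.1 (hu0 ▸ hx)
      simp [this, ← hu0]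
    rcases hv.eq_or_lt with hv0 | hv0
    · have : y = 0 := abs_nonpos_iff.1 (hv0 ▸ hy)
      simp [this, ← hv0]
    rcases (mul_nonneg hM hN).eq_or_lt with hMN | hMN
    · rw [← hMN, zero_mul, div_zero]
      positivity
    rw [← mul_div_assoc, div_le_div_iff₀ (by positivity) (by positivity)]
    linear_combination (x * v - y * u) ^ 2 * (u + v) * hkey
  rw [← hin] at hgap
  linarith

/-! ### The triangular discrimination as a measure of information -/

/-- The triangular discrimination `½ ∑ (q - p)² / (q + p)` of a pair `p = L false`, `q = L true` of
mass functions. If `X` is a uniform sign and `Y` has the law `p` or `q` according to `X`, this is the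
second moment of `E[X | Y]`. Values of mass zero contribute `0 / 0 = 0`. -/
noncomputable def triDisc {τ : Type*} [Fintype τ] (L : Bool → τ → ℝ) : ℝ :=
  1 / 2 * ∑ t, (L true t - L false t) ^ 2 / (L true t + L false t)

/-- The law of the statistic `φ e` under the mass function `w e`, for each hypothesis `e`. -/
noncomputable def law {Ω τ : Type*} [Fintype Ω] (w : Bool → Ω → ℝ)
    (φ : Bool → Ω → τ) (e : Bool) (t : τ) : ℝ :=
  open Classical in ∑ z, if φ e z = t then w e z else 0

theorem sq_sum_div_le_sum_sq_div_of_abs_le {σ : Type*} (s : Finset σ) {f g : σ → ℝ}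
    (h : ∀ i ∈ s, |f i| ≤ g i) : (∑ i ∈ s, f i) ^ 2 / ∑ i ∈ s, g i ≤ ∑ i ∈ s, f i ^ 2 / g i := by
  have hg : ∀ i ∈ s, 0 ≤ g i := fun i hi => (abs_nonneg _).trans (h i hi)
  have hq : ∀ i ∈ s, 0 ≤ f i ^ 2 / g i := fun i hi => div_nonneg (sq_nonneg _) (hg i hi)
  refine div_le_of_le_mul₀ (Finset.sum_nonneg hg) (Finset.sum_nonneg hq) ?_
  refine Finset.sum_sq_le_sum_mul_sum_of_sq_le_mul s hq hg fun i hi => ?_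
  rcases (hg i hi).eq_or_lt with h0 | h0
  · have : f i = 0 := abs_nonpos_iff.1 (h0 ▸ h i hi)
    simp [this]
  · rw [div_mul_cancel₀ _ h0.ne']

theorem abs_sub_le_add {p q : ℝ} (hp : 0 ≤ p) (hq : 0 ≤ q) : |q - p| ≤ q + p :=
  abs_sub_le_iff.2 ⟨by linarith, by linarith⟩

/-- Data processing: a function of the observation carries less information. -/
theorem triDisc_map_le {τ τ' : Type*} [Fintype τ] [Fintype τ'] [DecidableEq τ]
    {L : Bool → τ → ℝ} {L' : Bool → τ' → ℝ} (hL' : ∀ e t, 0 ≤ L' e t) (π : τ' → τ)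
    (h : ∀ e t, L e t = ∑ t' with π t' = t, L' e t') : triDisc L ≤ triDisc L' := by
  unfold triDisc
  rw [← Finset.sum_fiberwise (s := Finset.univ (α := τ')) π]
  gcongr with t
  rw [h, h, ← Finset.sum_sub_distrib, ← Finset.sum_add_distrib]
  exact sq_sum_div_le_sum_sq_div_of_abs_le _ fun t' _ => abs_sub_le_add (hL' _ _) (hL' _ _)

theorem triDisc_le_one {τ : Type*} [Fintype τ] {L : Bool → τ → ℝ} (hL : ∀ e t, 0 ≤ L e t)
    (hsum : ∀ e, ∑ t, L e t = 1) : triDisc L ≤ 1 := by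
  have h : ∑ t, (L true t - L false t) ^ 2 / (L true t + L false t) ≤
      ∑ t, (L true t + L false t) := by
    gcongr with t
    have h0 := add_nonneg (hL true t) (hL false t)
    refine div_le_of_le_mul₀ h0 h0 ?_
    rw [← sq, sq_le_sq, abs_of_nonneg h0]
    exact abs_sub_le_add (hL _ _) (hL _ _)
  rw [Finset.sum_add_distrib, hsum, hsum] at h
  unfold triDisc
  linarith

/-- A test that is wrong with probability at most `δ` under each hypothesis forces the triangular
discrimination up to `(1 - 2 δ)²`, by the Cauchy-Schwarz inequality. -/
theorem sq_le_triDisc_of_error_le {L : Bool → Bool → ℝ} (hL : ∀ e t, 0 ≤ L e t)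
    (hsum : ∀ e, ∑ t, L e t = 1) {δ : ℝ} (hδ : δ ≤ 1 / 2) (herr : ∀ e, L e (!e) ≤ δ) :
    (1 - 2 * δ) ^ 2 ≤ triDisc L := by
  have h1 := sq_sum_div_le_sum_sq_div_of_abs_le Finset.univ
    (f := fun t => if t then L true t - L false t else L false t - L true t)
    (g := fun t => L true t + L false t) (fun t _ => by
      cases t
      · simpa [add_comm] using abs_sub_le_add (hL true false) (hL false false)
      · simpa using abs_sub_le_add (hL false true) (hL true true))
  have ht := hsum true
  have hf := hsum false
  have et := herr true
  have ef := herr false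
  simp only [Fintype.sum_bool, Bool.not_true, Bool.not_false, if_true, Bool.false_eq_true,
    if_false] at *
  have e1 : L true true - L false true + (L false false - L true false)
      = 2 * (1 - L true false - L false true) := by linarith
  have e2 : L true true + L false true + (L true false + L false false) = 2 := by linarith
  rw [e1, e2] at h1
  have h2 : (1 - 2 * δ) ^ 2 ≤ (1 - L true false - L false true) ^ 2 :=
    pow_le_pow_left₀ (by linarith) (by linarith) 2
  have e3 : (L false false - L true false) ^ 2 = (L true false - L false false) ^ 2 := by ring
  unfold triDisc
  rw [Fintype.sum_bool, ← e3]
  linarith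

theorem noisyChannel_nonneg {a b : ℝ} (ha : a ∈ Set.Icc (0 : ℝ) 1) (hb : b ∈ Set.Icc (0 : ℝ) 1)
    (y z : Bool) : 0 ≤ noisyChannel a b y z := by
  obtain ⟨ha0, ha1⟩ := ha
  obtain ⟨hb0, hb1⟩ := hb
  cases y <;> cases z <;> simp [noisyChannel] <;> assumption

/-- Strong data processing: if a bit `B` is observed through the `(a, b)`-noisy channel next to side
information `T`, only the fraction `c` of what `B` adds to `T` is retained. -/
theorem triDisc_noisyChannel_le {τ : Type*} [Fintype τ] {a b : ℝ} (ha : a ∈ Set.Icc (0 : ℝ) 1)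
    (hb : b ∈ Set.Icc (0 : ℝ) 1) {L L' : Bool → τ × Bool → ℝ} {L₀ : Bool → τ → ℝ}
    (hL : ∀ e t, 0 ≤ L e t) (hL₀ : ∀ e t, L₀ e t = ∑ y, L e (t, y))
    (hL' : ∀ e t v, L' e (t, v) = ∑ y, L e (t, y) * noisyChannel a b y v) :
    triDisc L' ≤ (1 - transmissionFactor a b) * triDisc L₀ + transmissionFactor a b * triDisc L := by
  set c := transmissionFactor a b with hc
  have h : ∀ t, ∑ v, (L' true (t, v) - L' false (t, v)) ^ 2 / (L' true (t, v) + L' false (t, v)) ≤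
      (1 - c) * ((L₀ true t - L₀ false t) ^ 2 / (L₀ true t + L₀ false t)) +
      c * ∑ y, (L true (t, y) - L false (t, y)) ^ 2 / (L true (t, y) + L false (t, y)) := by
    intro t
    have h1 := noisyChannel_sq_div_le ha hb
      (abs_sub_le_add (hL false (t, false)) (hL true (t, false)))
      (abs_sub_le_add (hL false (t, true)) (hL true (t, true)))
    simp only [hL', hL₀, Fintype.sum_bool, noisyChannel]
    rw [← hc] at h1
    convert h1 using 1
    · rw [add_comm]
      congr 2 <;> ring
    · congr 2
      · congr 1 <;> ring
      · ring
  unfold triDisc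
  rw [Fintype.sum_prod_type, Fintype.sum_prod_type]
  have h2 := Finset.sum_le_sum fun t (_ : t ∈ Finset.univ) => h t
  rw [Finset.sum_add_distrib, ← Finset.mul_sum, ← Finset.mul_sum] at h2
  linarith

section law

variable {Ω τ τ' : Type*} [Fintype Ω] {w : Bool → Ω → ℝ}

theorem law_nonneg (hw : ∀ e z, 0 ≤ w e z) (φ : Bool → Ω → τ) (e : Bool) (t : τ) :
    0 ≤ law w φ e t :=
  Finset.sum_nonneg fun z _ => by split_ifs <;> simp [hw]

theorem law_comp [DecidableEq τ] [Fintype τ'] (φ : Bool → Ω → τ') (π : τ' → τ) (e : Bool) (t : τ) :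
    law w (fun e z => π (φ e z)) e t = ∑ t' with π t' = t, law w φ e t' := by
  unfold law
  rw [Finset.sum_comm]
  refine Finset.sum_congr rfl fun z _ => ?_
  rw [Finset.sum_filter, Fintype.sum_eq_single (φ e z) fun t' ht => by simp [ht.symm], if_pos rfl]
  congr

theorem sum_law [Fintype τ] (φ : Bool → Ω → τ) (e : Bool) : ∑ t, law w φ e t = ∑ z, w e z := by
  unfold law
  rw [Finset.sum_comm]
  refine Finset.sum_congr rfl fun z _ => ?_
  rw [Fintype.sum_eq_single (φ e z) fun t ht => if_neg ht.symm, if_pos rfl]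

theorem triDisc_law_comp_le [Fintype τ] [Fintype τ'] (hw : ∀ e z, 0 ≤ w e z)
    (φ : Bool → Ω → τ') (π : τ' → τ) :
    triDisc (law w fun e z => π (φ e z)) ≤ triDisc (law w φ) := by
  classical
  exact triDisc_map_le (law_nonneg hw φ) π (law_comp φ π)

end law

namespace BoolCircuit

variable {ι : Type*}

/-! ### Path weights -/

open Classical in
/-- The total weight of the directed paths from the variable `i` to the gate `g`, where a path
through `ℓ` gates (`g` included) has the weight `c ^ ℓ`. -/
noncomputable def gatePathWeight (C : BoolCircuit ι) (c : ℝ) (i : ι) : C.Gate → ℝ :=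
  C.acyclic.fix fun g weightOf =>
    c * ∑ p : Fin (C.arity g),
      match h : C.wire g p with
      | .input j => if j = i then 1 else 0
      | .const _ => 0
      | .gate g' => weightOf g' ⟨p, h⟩

open Classical in
/-- The total weight of the directed paths from the variable `i` to a vertex, where a path
through `ℓ` gates has the weight `c ^ ℓ`. -/
noncomputable def pathWeight (C : BoolCircuit ι) (c : ℝ) (i : ι) : CircuitVertex ι C.Gate → ℝ
  | .input j => if j = i then 1 else 0
  | .const _ => 0
  | .gate g => C.gatePathWeight c i g

theorem gatePathWeight_eq (C : BoolCircuit ι) (c : ℝ) (i : ι) (g : C.Gate) :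
    C.gatePathWeight c i g = c * ∑ p, C.pathWeight c i (C.wire g p) := by
  unfold gatePathWeight
  rw [WellFounded.fix_eq]
  congr 2
  funext p
  split <;> rename_i h <;> exact congrArg (C.pathWeight c i) h.symm

theorem gateDepth_lt (C : BoolCircuit ι) {g g' : C.Gate} {p : Fin (C.arity g)}
    (h : C.wire g p = .gate g') : C.gateDepth g' < C.gateDepth g := by
  rw [C.gateDepth_eq g, Nat.lt_one_add_iff]
  have := Finset.le_sup (f := fun p => C.vertexDepth (C.wire g p)) (Finset.mem_univ p)
  simpa [h, vertexDepth] using this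

theorem vertexDepth_wire_lt (C : BoolCircuit ι) (g : C.Gate) (p : Fin (C.arity g)) :
    C.vertexDepth (C.wire g p) + 1 ≤ C.gateDepth g := by
  rw [C.gateDepth_eq g, add_comm]
  exact Nat.add_le_add_left
    (Finset.le_sup (f := fun p => C.vertexDepth (C.wire g p)) (Finset.mem_univ p)) 1

theorem pathWeight_nonneg (C : BoolCircuit ι) {c : ℝ} (hc : 0 ≤ c) (i : ι)
    (v : CircuitVertex ι C.Gate) : 0 ≤ C.pathWeight c i v := by
  have hg : ∀ g, 0 ≤ C.gatePathWeight c i g := by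
    intro g
    induction g using C.acyclic.induction with
    | _ g ih =>
      rw [gatePathWeight_eq]
      refine mul_nonneg hc (Finset.sum_nonneg fun p _ => ?_)
      cases h : C.wire g p with
      | input j => simp only [pathWeight]; split_ifs <;> simp
      | const v => exact le_rfl
      | gate g' => exact ih g' ⟨p, h⟩
  cases v with
  | input j => simp only [pathWeight]; split_ifs <;> simp
  | const v => exact le_rfl
  | gate g => exact hg g

/-- Every vertex has at most one path of no gates from a variable, and a gate multiplies the
weight by at most `c k`. -/
theorem sum_pathWeight_le (C : BoolCircuit ι) {c : ℝ} (hc : 0 ≤ c) {k : ℕ}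
    (hk : ∀ g, C.arity g ≤ k) {R : ℝ} (hR1 : 1 ≤ R) (hR : c * k ≤ R) (A : Finset ι)
    (v : CircuitVertex ι C.Gate) :
    ∑ i ∈ A, C.pathWeight c i v ≤ R ^ C.vertexDepth v := by
  have hleaf : ∀ j, ∑ i ∈ A, C.pathWeight c i (.input j) ≤ 1 := by
    intro j
    classical
    have h : ∑ i ∈ A, C.pathWeight c i (.input j) = if j ∈ A then 1 else 0 := by
      simp only [pathWeight]
      convert Finset.sum_ite_eq A j fun _ => (1 : ℝ)
    rw [h]
    split_ifs <;> simp
  have hg : ∀ g, ∑ i ∈ A, C.gatePathWeight c i g ≤ R ^ C.gateDepth g := by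
    intro g
    induction g using C.acyclic.induction with
    | _ g ih =>
      have hw : ∀ p, ∑ i ∈ A, C.pathWeight c i (C.wire g p) ≤ R ^ (C.gateDepth g - 1) := by
        intro p
        have hp := C.vertexDepth_wire_lt g p
        refine le_trans ?_ (pow_le_pow_right₀ hR1 (Nat.le_sub_one_of_lt hp))
        cases h : C.wire g p with
        | input j => exact (hleaf j).trans (one_le_pow₀ hR1)
        | const v => simp [pathWeight, vertexDepth]
        | gate g' => exact ih g' ⟨p, h⟩
      have hpos : 0 < C.gateDepth g := by rw [gateDepth_eq]; omega
      simp only [gatePathWeight_eq]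
      rw [← Finset.mul_sum, Finset.sum_comm]
      calc c * ∑ p, ∑ i ∈ A, C.pathWeight c i (C.wire g p)
          ≤ c * ∑ _p : Fin (C.arity g), R ^ (C.gateDepth g - 1) := by
            gcongr with p
            exact hw p
        _ = c * C.arity g * R ^ (C.gateDepth g - 1) := by
            simp [mul_assoc]
        _ ≤ R * R ^ (C.gateDepth g - 1) := by
            gcongr
            refine le_trans ?_ hR
            gcongr
            exact hk g
        _ = R ^ C.gateDepth g := by
            rw [← pow_succ', Nat.sub_add_cancel hpos]
  cases v with
  | input j => exact (hleaf j).trans (one_le_pow₀ hR1)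
  | const v => simp [pathWeight, vertexDepth]
  | gate g => exact hg g

/-! ### Running the gates one at a time -/

/-- The probability that the gates emit the values `z` if only the gates in `D` run, on the input
`x`, while the others toss fair coins. -/
noncomputable def partialProb (C : BoolCircuit ι) (a b : ℝ) (D : Set C.Gate) (x : ι → Bool)
    (z : C.Gate → Bool) : ℝ :=
  open Classical in ∏ g, if g ∈ D then noisyChannel a b (C.preNoise x z g) (z g) else 1 / 2

/-- The values of the vertices in `S`, for the input assignment `x` and gate outputs `z`. -/
def values (C : BoolCircuit ι) (S : Finset (CircuitVertex ι C.Gate)) (x : ι → Bool)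
    (z : C.Gate → Bool) : S → Bool :=
  fun v => C.value x z v

theorem partialProb_nonneg (C : BoolCircuit ι) {a b : ℝ} (ha : a ∈ Set.Icc (0 : ℝ) 1)
    (hb : b ∈ Set.Icc (0 : ℝ) 1) (D : Set C.Gate) (x : ι → Bool) (z : C.Gate → Bool) :
    0 ≤ C.partialProb a b D x z := by
  refine Finset.prod_nonneg fun g _ => ?_
  split_ifs
  · exact noisyChannel_nonneg ha hb _ _
  · norm_num

open Classical in
theorem value_update (C : BoolCircuit ι) (x : ι → Bool) (z : C.Gate → Bool) {m : C.Gate} (u : Bool)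
    {v : CircuitVertex ι C.Gate} (h : v ≠ .gate m) :
    C.value x (Function.update z m u) v = C.value x z v := by
  cases v with
  | input i => rfl
  | const v => rfl
  | gate g =>
    have hne : g ≠ m := fun e => h (e ▸ rfl)
    simp [value, hne]

open Classical in
theorem values_update (C : BoolCircuit ι) {S : Finset (CircuitVertex ι C.Gate)} {m : C.Gate}
    (hS : .gate m ∉ S) (x : ι → Bool) (z : C.Gate → Bool) (u : Bool) :
    C.values S x (Function.update z m u) = C.values S x z := by
  funext ⟨v, hv⟩
  exact C.value_update x z u fun h => hS (h ▸ hv)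

open Classical in
/-- If a function does not depend on the output of the gate `m`, fixing that output to be `u`
halves its sum. -/
theorem two_mul_sum_ite_eq {G : Type*} [Fintype G] (m : G) (u : Bool) {F : (G → Bool) → ℝ}
    (hF : ∀ z v, F (Function.update z m v) = F z) :
    2 * ∑ z : G → Bool, (if z m = u then F z else 0) = ∑ z, F z := by
  let flip : (G → Bool) → (G → Bool) := fun z => Function.update z m (!z m)
  have hflip : Function.Involutive flip := by
    intro z
    funext g
    by_cases hg : g = m
    · subst hg; simp [flip]
    · simp [flip, hg]
  have hsym : ∑ z : G → Bool, (if z m = u then F z else 0) =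
      ∑ z : G → Bool, (if z m = u then 0 else F z) := by
    rw [← Equiv.sum_comp hflip.toPerm]
    refine Finset.sum_congr rfl fun z _ => ?_
    change (if flip z m = u then F (flip z) else 0) = _
    have h1 : flip z m = !z m := by simp [flip]
    rw [h1, hF]
    cases z m <;> cases u <;> simp
  rw [two_mul]
  nth_rewrite 2 [hsym]
  rw [← Finset.sum_add_distrib]
  refine Finset.sum_congr rfl fun z _ => ?_
  split_ifs <;> simp

open Classical in
/-- Starting one more gate `m`, read by no gate that runs already, sends its result through the
channel and leaves everything else as it was. -/
theorem sum_partialProb_insert (C : BoolCircuit ι) (a b : ℝ) {D : Set C.Gate} {m : C.Gate}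
    (hm : m ∉ D) (hD : ∀ g ∈ insert m D, ¬ ∃ p, C.wire g p = .gate m) (x : ι → Bool) (u : Bool)
    {F : (C.Gate → Bool) → ℝ} (hF : ∀ z v, F (Function.update z m v) = F z) :
    ∑ z, (if z m = u then C.partialProb a b (insert m D) x z * F z else 0) =
      ∑ z, C.partialProb a b D x z * noisyChannel a b (C.preNoise x z m) u * F z := by
  let r : C.Gate → (C.Gate → Bool) → ℝ := fun g z =>
    if g ∈ D then noisyChannel a b (C.preNoise x z g) (z g) else 1 / 2
  have hr : ∀ g ∈ Finset.univ.erase m, ∀ z v, r g (Function.update z m v) = r g z := by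
    intro g hg z v
    have hgm := Finset.ne_of_mem_erase hg
    simp only [r]
    split_ifs with h
    · rw [C.preNoise_update x z m g v (hD g (Set.mem_insert_of_mem m h)),
        Function.update_of_ne hgm]
    · rfl
  have hsmall : ∀ z, C.partialProb a b D x z = 1 / 2 * ∏ g ∈ Finset.univ.erase m, r g z := by
    intro z
    unfold partialProb
    rw [← Finset.mul_prod_erase _ _ (Finset.mem_univ m), if_neg hm]
  have hbig : ∀ z, C.partialProb a b (insert m D) x z =
      2 * (C.partialProb a b D x z * noisyChannel a b (C.preNoise x z m) (z m)) := by
    intro z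
    rw [hsmall]
    unfold partialProb
    rw [← Finset.mul_prod_erase _ _ (Finset.mem_univ m), if_pos (Set.mem_insert m D)]
    refine Eq.trans (congrArg (_ * ·) (Finset.prod_congr rfl (g := fun g => r g z) fun g hg => ?_)) ?_
    · simp [r, Set.mem_insert_iff, Finset.ne_of_mem_erase hg]
    · ring
  rw [← two_mul_sum_ite_eq m u (F := fun z =>
    C.partialProb a b D x z * noisyChannel a b (C.preNoise x z m) u * F z), Finset.mul_sum]
  · refine Finset.sum_congr rfl fun z _ => ?_
    rw [hbig]
    split_ifs with h
    · rw [h]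
      ring
    · simp
  · intro z v
    rw [hF, hsmall, hsmall, C.preNoise_update x z m m v (hD m (Set.mem_insert m D)),
      Finset.prod_congr rfl fun g hg => hr g hg z v]

section law

variable {τ : Type*} (C : BoolCircuit ι) (a b : ℝ) {D : Set C.Gate} {m : C.Gate}
  {x : Bool → ι → Bool} {φ : Bool → (C.Gate → Bool) → τ}

open Classical in
theorem law_partialProb_insert (hm : m ∉ D)
    (hD : ∀ g ∈ insert m D, ¬ ∃ p, C.wire g p = .gate m)
    (hφ : ∀ e z v, φ e (Function.update z m v) = φ e z) (e : Bool) (t : τ) (u : Bool) :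
    law (fun e => C.partialProb a b (insert m D) (x e)) (fun e z => (φ e z, z m)) e (t, u) =
      ∑ y, law (fun e => C.partialProb a b D (x e))
        (fun e z => (φ e z, C.preNoise (x e) z m)) e (t, y) * noisyChannel a b y u := by
  have h := C.sum_partialProb_insert a b hm hD (x e) u
    (F := fun z => if φ e z = t then 1 else 0) (fun z v => by rw [hφ])
  simp only [law, Finset.sum_mul]
  rw [Finset.sum_comm]
  refine Eq.trans (Finset.sum_congr rfl fun z _ => ?_) (h.trans (Finset.sum_congr rfl fun z _ => ?_))
  · by_cases h1 : φ e z = t <;> by_cases h2 : z m = u <;> simp [h1, h2]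
  · rw [Fintype.sum_bool]
    by_cases h1 : φ e z = t <;> cases C.preNoise (x e) z m <;> simp [h1]

open Classical in
theorem law_partialProb_insert_of_update_eq (hm : m ∉ D)
    (hD : ∀ g ∈ insert m D, ¬ ∃ p, C.wire g p = .gate m)
    (hφ : ∀ e z v, φ e (Function.update z m v) = φ e z) :
    law (fun e => C.partialProb a b (insert m D) (x e)) φ =
      law (fun e => C.partialProb a b D (x e)) φ := by
  funext e t
  have h := fun u => C.sum_partialProb_insert a b hm hD (x e) u
    (F := fun z => if φ e z = t then 1 else 0) (fun z v => by rw [hφ])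
  have h' := congrArg₂ (fun p q : ℝ => p + q) (h true) (h false)
  simp only [← Finset.sum_add_distrib] at h'
  unfold law
  refine Eq.trans (Finset.sum_congr rfl fun z _ => ?_)
    (h'.trans (Finset.sum_congr rfl fun z _ => ?_))
  · by_cases h1 : φ e z = t <;> cases z m <;> simp [h1]
  · by_cases h1 : φ e z = t <;> cases C.preNoise (x e) z m <;>
      simp [h1, noisyChannel] <;> ring

end law

/-! ### Propagation of information through the circuit -/

open Classical in
/-- Instead of the gate `m` read by no other running gate, one may observe the vertices that feed
it, at the exchange rate `c`: by the strong data processing inequality, the output of `m` retains at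
most the fraction `c` of what they add to the values of the vertices in `S`. -/
theorem triDisc_values_insert_le (C : BoolCircuit ι) {a b : ℝ} (ha : a ∈ Set.Icc (0 : ℝ) 1)
    (hb : b ∈ Set.Icc (0 : ℝ) 1) (x : Bool → ι → Bool) {D : Set C.Gate} {m : C.Gate} (hm : m ∉ D)
    (hD : ∀ g ∈ insert m D, ¬ ∃ p, C.wire g p = .gate m)
    {S : Finset (CircuitVertex ι C.Gate)} (hS : .gate m ∉ S) :
    triDisc (law (fun e => C.partialProb a b (insert m D) (x e))
        fun e => C.values (insert (.gate m) S) (x e)) ≤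
      (1 - transmissionFactor a b) *
        triDisc (law (fun e => C.partialProb a b D (x e)) fun e => C.values S (x e)) +
      transmissionFactor a b * triDisc (law (fun e => C.partialProb a b D (x e))
        fun e => C.values (S ∪ Finset.univ.image (C.wire m)) (x e)) := by
  have hnn : ∀ e z, 0 ≤ C.partialProb a b (insert m D) (x e) z := fun e =>
    C.partialProb_nonneg ha hb _ _
  have hnn' : ∀ e z, 0 ≤ C.partialProb a b D (x e) z := fun e => C.partialProb_nonneg ha hb _ _
  have hpT : ∀ p, C.wire m p ∈ S ∪ Finset.univ.image (C.wire m) := fun p =>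
    Finset.mem_union_right _ (Finset.mem_image_of_mem _ (Finset.mem_univ p))
  have h1 := triDisc_law_comp_le hnn (fun e z => (C.values S (x e) z, z m))
    (fun q v => if h : v.1 ∈ S then q.1 ⟨v.1, h⟩ else q.2 :
      (S → Bool) × Bool → (insert (.gate m) S : Finset (CircuitVertex ι C.Gate)) → Bool)
  have hval : (fun e : Bool => C.values (insert (.gate m) S) (x e)) = fun e z v =>
      if h : v.1 ∈ S then C.values S (x e) z ⟨v.1, h⟩ else z m := by
    funext e z ⟨v, hv⟩
    by_cases h : v ∈ S
    · simp [h, values]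
    · obtain rfl := (Finset.mem_insert.1 hv).resolve_right h
      simp [h, values, value]
  rw [hval]
  refine h1.trans ((triDisc_noisyChannel_le ha hb
    (L₀ := law (fun e => C.partialProb a b D (x e)) fun e => C.values S (x e))
    (law_nonneg hnn' _) (fun e t => ?_)
    (C.law_partialProb_insert a b hm hD fun e z u => ?_)).trans ?_)
  · simp only [law]
    rw [Finset.sum_comm]
    refine Finset.sum_congr rfl fun z _ => ?_
    rw [Fintype.sum_bool]
    by_cases h : C.values S (x e) z = t <;> cases C.preNoise (x e) z m <;> simp [h]
  · exact C.values_update hS (x e) z u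
  · refine add_le_add_right (mul_le_mul_of_nonneg_left ?_ (transmissionFactor_nonneg ha hb)) _
    let π : ((S ∪ Finset.univ.image (C.wire m) : Finset (CircuitVertex ι C.Gate)) → Bool) →
        (S → Bool) × Bool := fun q =>
      (fun v => q ⟨v.1, Finset.mem_union_left _ v.2⟩, C.op m fun p => q ⟨C.wire m p, hpT p⟩)
    have hπ : (fun (e : Bool) z => (C.values S (x e) z, C.preNoise (x e) z m)) =
        fun e z => π (C.values _ (x e) z) := rfl
    rw [hπ]
    exact triDisc_law_comp_le hnn' _ π

open Classical in
/-- The information which the values of the vertices in `S` carry about the variable `i`, the only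
one in which the assignments `x false` and `x true` differ, is at most the total weight of the paths
from `i` to `S`. The gates are removed from the set `D` of running gates deepest first; removing the
gate `m` from `S` costs the fraction `c` of what the wires into `m` add to the rest of `S`. -/
theorem triDisc_values_le (C : BoolCircuit ι) {a b : ℝ} (ha : a ∈ Set.Icc (0 : ℝ) 1)
    (hb : b ∈ Set.Icc (0 : ℝ) 1) {x : Bool → ι → Bool} {i : ι}
    (hx : ∀ j, j ≠ i → x false j = x true j) (D : Finset C.Gate)
    (hD : ∀ g ∈ D, ∀ p g', C.wire g p = .gate g' → g' ∈ D)
    (S : Finset (CircuitVertex ι C.Gate)) (hS : ∀ g, .gate g ∈ S → g ∈ D) :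
    triDisc (law (fun e => C.partialProb a b D (x e)) fun e => C.values S (x e)) ≤
      ∑ v ∈ S, C.pathWeight (transmissionFactor a b) i v := by
  set c := transmissionFactor a b with hc
  have hc0 : 0 ≤ c := transmissionFactor_nonneg ha hb
  have hc1 : c ≤ 1 := transmissionFactor_le_one a b
  have hW := C.pathWeight_nonneg hc0 i
  induction hN : D.card generalizing D S with
  | zero =>
    rw [Finset.card_eq_zero] at hN
    subst hN
    have hsum : ∀ e, ∑ z, C.partialProb a b (∅ : Finset C.Gate) (x e) z = 1 := by
      intro e
      simp [partialProb]
    by_cases hi : .input i ∈ S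
    · calc _ ≤ 1 := triDisc_le_one (law_nonneg (fun e => C.partialProb_nonneg ha hb _ _) _)
            fun e => by rw [sum_law, hsum]
        _ = C.pathWeight c i (.input i) := by simp [pathWeight]
        _ ≤ _ := Finset.single_le_sum (fun v _ => hW v) hi
    · -- No vertex of `S` sees the variable `i`, so the two laws agree.
      have heq : ∀ z, C.values S (x true) z = C.values S (x false) z := by
        intro z
        funext ⟨v, hv⟩
        cases v with
        | input j => exact (hx j fun e => hi (e ▸ hv)).symm
        | const v => rfl
        | gate g => rfl
      have hlaw : ∀ t, law (fun e => C.partialProb a b (∅ : Finset C.Gate) (x e))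
          (fun e => C.values S (x e)) true t =
          law (fun e => C.partialProb a b (∅ : Finset C.Gate) (x e))
          (fun e => C.values S (x e)) false t := by
        intro t
        refine Finset.sum_congr rfl fun z _ => ?_
        by_cases h : C.values S (x false) z = t <;> simp [heq, h, partialProb]
      refine le_trans (le_of_eq ?_) (Finset.sum_nonneg fun v _ => hW v)
      simp only [triDisc, hlaw, sub_self, ne_eq, OfNat.ofNat_ne_zero, not_false_eq_true, zero_pow,
        zero_div, Finset.sum_const_zero, mul_zero]
  | succ N ih =>
    obtain ⟨m, hmD, hmax⟩ := D.exists_max_image C.gateDepth (Finset.card_pos.1 (by omega))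
    have hno : ∀ g ∈ D, ¬ ∃ p, C.wire g p = .gate m := fun g hg ⟨p, hp⟩ =>
      (C.gateDepth_lt hp).not_ge (hmax g hg)
    have hcoe : (D : Set C.Gate) = insert m ((D.erase m : Finset C.Gate) : Set C.Gate) := by
      rw [← Finset.coe_insert, Finset.insert_erase hmD]
    have hno' : ∀ g ∈ insert m ((D.erase m : Finset C.Gate) : Set C.Gate),
        ¬ ∃ p, C.wire g p = .gate m := by
      rw [← hcoe]
      exact hno
    have hmE : m ∉ ((D.erase m : Finset C.Gate) : Set C.Gate) := by simp
    have hDE : ∀ g ∈ D.erase m, ∀ p g', C.wire g p = .gate g' → g' ∈ D.erase m := by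
      intro g hg p g' hp
      have hgD := Finset.mem_of_mem_erase hg
      exact Finset.mem_erase.2 ⟨fun e => hno g hgD ⟨p, e ▸ hp⟩, hD g hgD p g' hp⟩
    have ih' := fun T hT => ih (D.erase m) hDE T hT (by rw [Finset.card_erase_of_mem hmD]; omega)
    by_cases hmS : .gate m ∈ S
    · obtain ⟨S', hmS', rfl⟩ : ∃ S', .gate m ∉ S' ∧ insert (.gate m) S' = S :=
        ⟨S.erase (.gate m), Finset.notMem_erase _ _, Finset.insert_erase hmS⟩
      have hS'E : ∀ g, .gate g ∈ S' → g ∈ D.erase m := fun g hg =>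
        Finset.mem_erase.2 ⟨fun e => hmS' (e ▸ hg), hS g (Finset.mem_insert_of_mem hg)⟩
      have hTE : ∀ g, .gate g ∈ S' ∪ Finset.univ.image (C.wire m) → g ∈ D.erase m := by
        intro g hg
        rcases Finset.mem_union.1 hg with h | h
        · exact hS'E g h
        · obtain ⟨p, -, hp⟩ := Finset.mem_image.1 h
          exact Finset.mem_erase.2 ⟨fun e => hno m hmD ⟨p, e ▸ hp⟩, hD m hmD p g hp⟩
      have hT : ∑ v ∈ S' ∪ Finset.univ.image (C.wire m), C.pathWeight c i v ≤
          ∑ v ∈ S', C.pathWeight c i v + ∑ p, C.pathWeight c i (C.wire m p) := by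
        rw [← Finset.sdiff_union_self_eq_union, Finset.sum_union Finset.sdiff_disjoint]
        exact add_le_add
          (Finset.sum_le_sum_of_subset_of_nonneg Finset.sdiff_subset fun v _ _ => hW v)
          (Finset.sum_image_le_of_nonneg fun v _ => hW v)
      have h1 := mul_le_mul_of_nonneg_left (ih' S' hS'E) (sub_nonneg.2 hc1)
      have h2 := mul_le_mul_of_nonneg_left ((ih' _ hTE).trans hT) hc0
      have h3 : C.pathWeight c i (.gate m) = c * ∑ p, C.pathWeight c i (C.wire m p) :=
        C.gatePathWeight_eq c i m
      rw [Finset.sum_insert hmS', h3, hcoe]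
      refine (C.triDisc_values_insert_le ha hb x hmE hno' hmS').trans ((add_le_add h1 h2).trans ?_)
      exact le_of_eq (by ring)
    · rw [hcoe, C.law_partialProb_insert_of_update_eq a b hmE hno' fun e z u =>
        C.values_update hmS (x e) z u]
      exact ih' S fun g hg => Finset.mem_erase.2 ⟨fun e => hmS (e ▸ hg), hS g hg⟩

/-- A function that depends on the variable `i` can only be computed reliably if enough path weight
leads from `i` to the output. -/
theorem sq_le_pathWeight_out (C : BoolCircuit ι) {a b : ℝ} (ha : a ∈ Set.Icc (0 : ℝ) 1)
    (hb : b ∈ Set.Icc (0 : ℝ) 1) {f : (ι → Bool) → Bool} {δ : ℝ} (hδ : δ ≤ 1 / 2)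
    (hC : C.ComputesReliably a b f δ) {i : ι} (hi : DependsOnInput f i) :
    (1 - 2 * δ) ^ 2 ≤ C.pathWeight (transmissionFactor a b) i C.out := by
  classical
  obtain ⟨x, hx, hfx⟩ : ∃ x : Bool → ι → Bool,
      (∀ j, j ≠ i → x false j = x true j) ∧ ∀ e, f (x e) = e := by
    obtain ⟨x, y, hxy, hne⟩ := hi
    cases h1 : f x <;> cases h2 : f y
    · simp_all
    · exact ⟨fun e => if e then y else x, by simpa using hxy, by simp [h1, h2]⟩
    · exact ⟨fun e => if e then x else y, by simpa using fun j hj => (hxy j hj).symm,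
        by simp [h1, h2]⟩
    · simp_all
  have hfull : ∀ e, C.partialProb a b (Finset.univ : Finset C.Gate) (x e) =
      C.jointProb a b (x e) := by
    intro e
    funext z
    simp [partialProb, jointProb]
  have hinfo := C.triDisc_values_le ha hb hx Finset.univ (fun _ _ _ _ _ => Finset.mem_univ _)
    {C.out} fun _ _ => Finset.mem_univ _
  simp only [hfull, Finset.sum_singleton] at hinfo
  have hnn : ∀ e z, 0 ≤ C.jointProb a b (x e) z := fun e => C.jointProb_nonneg ha hb _
  refine le_trans ?_ hinfo
  refine le_trans ?_ (triDisc_law_comp_le hnn _ fun q => q ⟨C.out, Finset.mem_singleton_self _⟩)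
  refine sq_le_triDisc_of_error_le (law_nonneg hnn _) (fun e => ?_) hδ fun e => ?_
  · rw [sum_law]
    convert C.sum_jointProb a b (x e)
  · refine le_trans (le_of_eq ?_) (hC (x e))
    unfold law errorProb
    rw [hfx]
    refine Finset.sum_congr (by congr!) fun z _ => ?_
    simp [values, Bool.eq_not]

end BoolCircuit

/-! ### The depth bound -/

theorem mainTheorem1 {ι : Type*} [Finite ι] (f : (ι → Bool) → Bool) (n : ℕ) (hn : 1 ≤ n)
    (hf : {i : ι | DependsOnInput f i}.ncard = n)
    (a b : ℝ) (ha : a ∈ Set.Icc (0 : ℝ) 1) (hb : b ∈ Set.Icc (0 : ℝ) 1)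
    (k d : ℕ) (C : BoolCircuit ι) (hk : ∀ g, C.arity g ≤ k) (hd : C.depth = d)
    (δ : ℝ) (hδ : δ ≤ 1 / 2) (hC : C.ComputesReliably a b f δ) :
    (1 < transmissionFactor a b * (k : ℝ) →
      Real.log ((n : ℝ) * (1 - binEntropyBits δ)) / Real.log (transmissionFactor a b * (k : ℝ))
        ≤ (d : ℝ)) ∧
    (transmissionFactor a b * (k : ℝ) ≤ 1 → 1 - binEntropyBits δ ≤ 1 / (n : ℝ)) := by
  classical
  have hc := transmissionFactor_nonneg ha hb
  have hδ0 : 0 ≤ δ := by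
    refine le_trans (Finset.sum_nonneg fun z _ => ?_) (hC fun _ => false)
    split_ifs
    · exact C.jointProb_nonneg ha hb _ _
    · exact le_rfl
  have hΔ0 : 0 ≤ 1 - binEntropyBits δ := by
    have h := Real.binEntropy_le_log_two (p := δ)
    rw [← div_le_one (Real.log_pos one_lt_two)] at h
    exact sub_nonneg.2 h
  have hfin := Set.toFinite {i : ι | DependsOnInput f i}
  have key : ∀ R : ℝ, 1 ≤ R → transmissionFactor a b * k ≤ R →
      (n : ℝ) * (1 - binEntropyBits δ) ≤ R ^ d := by
    intro R hR1 hR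
    have h1 := C.sum_pathWeight_le hc hk hR1 hR hfin.toFinset C.out
    refine le_trans ?_ (h1.trans_eq (congrArg (R ^ ·) hd))
    rw [← hf, Set.ncard_eq_toFinset_card _ hfin, ← nsmul_eq_mul]
    refine Finset.card_nsmul_le_sum _ _ _ fun i hi => ?_
    exact (one_sub_binEntropyBits_le hδ0 hδ).trans
      (C.sq_le_pathWeight_out ha hb hδ hC (by simpa using hi))
  refine ⟨fun h => ?_, fun h => ?_⟩
  · rw [div_le_iff₀ (Real.log_pos h), ← Real.log_pow]
    rcases (mul_nonneg n.cast_nonneg hΔ0).eq_or_lt with h0 | h0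
    · rw [← h0, Real.log_zero]
      exact Real.log_nonneg (one_le_pow₀ h.le)
    · exact Real.log_le_log h0 (key _ h.le le_rfl)
  · have h1 := key 1 le_rfl h
    rw [one_pow] at h1
    rw [le_div_iff₀ (by exact_mod_cast hn), mul_comm]
    exact h1
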